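/- Let $R$ be a commutative ring. A \emph{tensor category} over $R$ is a locally finitely presentable $R$-linear closed symmetric monoidal category with $R$-bilinear tensor product, finitely presentable unit $I$, and finitely presentable objects closed under $\otimes$; a \emph{tensor functor} is an $R$-linear symmetric strong monoidal functor having a right adjoint. A tensor category is \emph{pre-geometric} if it is abelian and its objects with duals form a generator; it is \emph{geometric} if moreover there are a commutative $R$-algebra $B$ and a faithful exact tensor functor to $\mathrm{Mod}_B$. A tensor functor is \emph{cohomologically affine} if its right adjoint is faithful and right exact. A commutative algebra $A$ in $\mathcal{C}$ is \emph{affine} if it is a projective generator of the category $\mathcal{C}_A$ of $A$-modules, and \emph{faithfully flat} if $A\otimes-\colon\mathcal{C}\to\mathcal{C}$ is faithful and exact. Let $\mathcal{C}$ be a geometric category, $\mathcal{D}$ an arbitrary tensor category over $R$, and $F\colon\mathcal{C}\to\mathcal{D}$ a cohomologically affine tensor functor whose right adjoint reflects isomorphisms (which is automatic if $\mathcal{D}$ is abelian). Then $\mathcal{D}$ is geometric. Moreover, for every faithfully flat affine commutative algebra $A$ in $\mathcal{C}$, the commutative algebra $FA$ in $\mathcal{D}$ is faithfully flat and affine. 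-/

import Mathlib

open CategoryTheory MonoidalCategory Limits
open scoped CategoryTheory.Obj

universe w v u u₁ u₂

namespace GeomTensor

section Categories

variable (R : Type w) [CommRing R] (C : Type u) [Category.{v} C] [Preadditive C] [Linear R C]
  [MonoidalCategory C] [SymmetricCategory C]

/-- A tensor category over `R`: a locally finitely presentable `R`-linear closed symmetric monoidal
category whose tensor product is `R`-bilinear, whose unit object is finitely presentable and whose
finitely presentable objects are closed under the tensor product. -/
class IsTensorCategory : Prop where
  [monoidalPreadditive : MonoidalPreadditive C]
  [monoidalLinear : MonoidalLinear R C]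
  [locallyFinitelyPresentable : IsLocallyFinitelyPresentable.{v} C]
  closed : ∀ X : C, (tensorLeft X).IsLeftAdjoint
  unit_fp : IsFinitelyPresentable.{v} (𝟙_ C)
  tensor_fp : ∀ X Y : C, IsFinitelyPresentable.{v} X → IsFinitelyPresentable.{v} Y →
    IsFinitelyPresentable.{v} (X ⊗ Y)

/-- A preadditive category is abelian (as a property: this is `CategoryTheory.Abelian`, for the
given preadditive structure). -/
class IsAbelianCat (C : Type u) [Category.{v} C] [Preadditive C] : Prop where
  [hasFiniteProducts : HasFiniteProducts C]
  [hasKernels : HasKernels C]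
  [hasCokernels : HasCokernels C]
  [normalMono : IsNormalMonoCategory C]
  [normalEpi : IsNormalEpiCategory C]

/-- The objects with duals. (In a symmetric monoidal category left and right duals agree.) -/
def hasDual (C : Type u) [Category.{v} C] [MonoidalCategory C] : ObjectProperty C :=
  fun X ↦ Nonempty (HasRightDual X)

/-- A pre-geometric category: an abelian tensor category in which the objects with duals form
a generator. -/
class IsPregeometric : Prop extends IsTensorCategory R C where
  abelian : IsAbelianCat C
  generator : (hasDual C).IsSeparating

end Categories

/-- An `R`-linear symmetric strong monoidal functor is a tensor functor if it has a right adjoint.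
(The symmetric strong monoidal structure is the data `F.Braided`.) -/
class IsTensorFunctor (R : Type w) [CommRing R]
    {C : Type u₁} [Category.{v} C] [Preadditive C] [Linear R C] [MonoidalCategory C]
    [SymmetricCategory C]
    {D : Type u₂} [Category.{v} D] [Preadditive D] [Linear R D] [MonoidalCategory D]
    [SymmetricCategory D] (F : C ⥤ D) [F.Braided] : Prop where
  [additive : F.Additive]
  [linear : F.Linear R]
  [isLeftAdjoint : F.IsLeftAdjoint]

attribute [instance] IsTensorFunctor.isLeftAdjoint

/-- A tensor functor is cohomologically affine if its right adjoint is faithful and right exact. -/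
class IsCohomologicallyAffine {C : Type u₁} [Category.{v} C] {D : Type u₂} [Category.{v} D]
    (F : C ⥤ D) [F.IsLeftAdjoint] : Prop where
  [faithful : F.rightAdjoint.Faithful]
  [rightExact : PreservesFiniteColimits F.rightAdjoint]

open scoped ModuleCat.Algebra in
/-- A faithfully flat covering is a faithful exact tensor functor to the tensor category of modules
over a commutative `R`-algebra. -/
class IsFaithfullyFlatCovering (R : Type w) [CommRing R]
    {C : Type u} [Category.{v} C] [Preadditive C] [Linear R C] [MonoidalCategory C]
    [SymmetricCategory C] (B : Type v) [CommRing B] [Algebra R B]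
    (W : C ⥤ ModuleCat.{v} B) [W.Braided] : Prop extends IsTensorFunctor R W where
  [faithful : W.Faithful]
  [leftExact : PreservesFiniteLimits W]
  [rightExact : PreservesFiniteColimits W]

/-- A geometric category: a pre-geometric category which has a faithfully flat covering. -/
class IsGeometric (R : Type w) [CommRing R] (C : Type u) [Category.{v} C] [Preadditive C]
    [Linear R C] [MonoidalCategory C] [SymmetricCategory C] : Prop
    extends IsPregeometric R C where
  exists_covering : ∃ (B : Type v) (_ : CommRing B) (_ : Algebra R B)
    (W : C ⥤ ModuleCat.{v} B) (_ : W.Braided), IsFaithfullyFlatCovering R B W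

section Algebras

variable {C : Type u} [Category.{v} C] [MonoidalCategory C] [SymmetricCategory C]
  (A : C) [MonObj A] [IsCommMonObj A]

/-- A commutative algebra `A` is affine if `A` is a projective generator of the category of
`A`-modules. -/
class IsAffineAlgebra : Prop where
  projective : Projective (Mod.regular A)
  generator : IsSeparator (Mod.regular A)

/-- A commutative algebra `A` is faithfully flat if `A ⊗ -` is faithful and exact. -/
class IsFaithfullyFlatAlgebra : Prop where
  [faithful : (tensorLeft A).Faithful]
  [leftExact : PreservesFiniteLimits (tensorLeft A)]
  [rightExact : PreservesFiniteColimits (tensorLeft A)]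

end Algebras

end GeomTensor

/-! Let `G` be the right adjoint of `F`, let `W : C ⥤ Mod_B` be a faithfully flat covering, and put
`L = G ⋙ W`. The covering of `D` is `L` itself, with scalars enlarged from `B` to the commutative
ring `L(𝟙)`.

Pre-geometricity: `G` is right exact and conservative, hence monadic, so `D` has finite limits; `G`
is then exact and conservative into an abelian category, so `D` is abelian. Since `G` is faithful,
the images `F Z` of dualizable `Z` separate `D`, and they are dualizable.

Cocontinuity: dualizable objects are finitely presentable because the unit is. Thus `F` preserves
the finite presentability of a separating family, which makes `G` preserve coproducts, hence all
colimits. So `L` is faithful, exact, cocontinuous and lax symmetric monoidal.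

Strong monoidality: the unit of the adjunction gives projection maps `W Z ⊗_B L Y ⟶ L(F Z ⊗ Y)`. For
dualizable `Z` the duality data provide an inverse; for general `Z` a presentation by dualizables
does the rest. The case `Y = 𝟙` says `L(F Z) ≅ W Z ⊗_B L(𝟙)`, so over `L(𝟙)` the structure map `L(F
Z) ⊗ L Y ⟶ L(F Z ⊗ Y)` is invertible; since the `F Z` separate and everything is cocontinuous, it is
invertible at all objects.

Algebras: the projection formula gives `L(F A ⊗ Y) ≅ W(A ⊗ G Y)`, so faithful flatness passes from
`A` to `F A`. Linear maps from an algebra to a module `M` are elements `𝟙 ⟶ M`, and elements of `M`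
in `D` are elements of `G M` in `C`, so affineness passes as well. -/

namespace GeomTensor

/-! ### Comparing cocontinuous functors on a separating family -/

section Separating

variable {C : Type u₁} [Category.{v} C] [Abelian C] [HasColimits C]
  {E : Type u₂} [Category.{v} E]

/-- A natural transformation between cocontinuous functors on a cocomplete abelian category is an
isomorphism as soon as it is so at the objects of a small separating family. -/
lemma isIso_app_of_isSeparating {ι : Type v} (Z : ι → C)
    (hZ : (ObjectProperty.ofObj Z).IsSeparating) {H₁ H₂ : C ⥤ E}
    [PreservesColimits H₁] [PreservesColimits H₂] (τ : H₁ ⟶ H₂)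
    (h : ∀ i, IsIso (τ.app (Z i))) (X : C) : IsIso (τ.app X) := by
  -- Every object is a quotient of a coproduct of the `Z i`, indexed by all maps into it;
  -- cocontinuity makes `τ` invertible there.
  have hfree (T : C) : ∃ (P : C) (p : P ⟶ T), Epi p ∧ IsIso (τ.app P) := by
    let K : (Σ i, (Z i ⟶ T)) → C := fun j ↦ Z j.1
    refine ⟨∐ K, Sigma.desc fun j ↦ j.2, ⟨fun u v huv ↦ hZ _ _ ?_⟩, ?_⟩
    · rintro _ ⟨i⟩ f
      simpa using Sigma.ι K ⟨i, f⟩ ≫= huv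
    · have : IsIso (Functor.whiskerLeft (Discrete.functor K) τ) := by
        have (j : Discrete (Σ i, (Z i ⟶ T))) :
            IsIso ((Functor.whiskerLeft (Discrete.functor K) τ).app j) := h _
        exact NatIso.isIso_of_isIso_app _
      exact isIso_app_coconePt_of_preservesColimit (Discrete.functor K) τ _
        (colimit.isColimit (Discrete.functor K))
  -- Covering the kernel as well presents `X` as a cokernel of a map between such coproducts.
  obtain ⟨P, p, hp, hP⟩ := hfree X
  obtain ⟨Q, q, hq, hQ⟩ := hfree (kernel p)
  have hw : (q ≫ kernel.ι p) ≫ p = 0 := by simp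
  let c : CokernelCofork (q ≫ kernel.ι p) := CokernelCofork.ofπ p hw
  have hc : IsColimit c := isCokernelEpiComp
    (Abelian.epiIsCokernelOfKernel (KernelFork.ofι (kernel.ι p) (kernel.condition p))
      (kernelIsKernel p)) q rfl
  have : IsIso (Functor.whiskerLeft (parallelPair (q ≫ kernel.ι p) 0) τ) := by
    have (j : WalkingParallelPair) :
        IsIso ((Functor.whiskerLeft (parallelPair (q ≫ kernel.ι p) 0) τ).app j) := by
      cases j
      · exact hQ
      · exact hP
    exact NatIso.isIso_of_isIso_app _
  exact isIso_app_coconePt_of_preservesColimit _ τ c hc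

end Separating

/-! ### Finite presentability and cocontinuity of the right adjoint -/

section FinitelyPresentable

/-- A morphism from a finitely presentable object to a coproduct is a finite sum of morphisms to
the summands. -/
lemma exists_eq_sum_of_isFinitelyPresentable {C : Type u} [Category.{v} C] [Preadditive C]
    [HasColimits C] (Z : C) (hZ : IsFinitelyPresentable.{v} Z) {α : Type v} (f : α → C)
    (t : Z ⟶ ∐ f) :
    ∃ (S : Finset (Discrete α)) (s : ∀ i : S, Z ⟶ f i.1.as),
      t = ∑ i : S, s i ≫ Sigma.ι f i.1.as := by
  obtain ⟨S, p, rfl⟩ := IsFinitelyPresentable.exists_hom_of_isColimit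
    (CoproductsFromFiniteFiltered.isColimitFiniteSubproductsCocone f) t
  classical
  let K : S → C := fun i ↦ f i.1.as
  change Z ⟶ ∐ K at p
  have hid : 𝟙 (∐ K) = ∑ i : S, Sigma.π K i ≫ Sigma.ι K i := by
    refine Sigma.hom_ext _ _ fun j ↦ ?_
    rw [Preadditive.comp_sum, Finset.sum_eq_single j]
    · simp
    · intro i _ hij
      rw [Sigma.ι_π_of_ne_assoc _ hij.symm, zero_comp]
    · simp
  refine ⟨S, fun i ↦ p ≫ Sigma.π K i, ?_⟩
  change p ≫ Sigma.desc (fun s : S ↦ Sigma.ι f s.1.as) = _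
  rw [← Category.id_comp (Sigma.desc _), hid, Preadditive.sum_comp, Preadditive.comp_sum]
  simp [K]

variable {C : Type u₁} [Category.{v} C] [Abelian C] [HasColimits C]
  {D : Type u₂} [Category.{v} D] [Preadditive D] [HasColimits D]

/-- If finitely presentable objects with finitely presentable image under `F` separate, then
the right adjoint of `F` preserves coproducts. -/
lemma preservesCoproducts_of_isFinitelyPresentable {F : C ⥤ D} {G : D ⥤ C} [F.Additive]
    (adj : F ⊣ G) {P : ObjectProperty C} (hP : P.IsSeparating)
    (hfp : ∀ Z, P Z → IsFinitelyPresentable.{v} Z)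
    (hFfp : ∀ Z, P Z → IsFinitelyPresentable.{v} (F.obj Z)) {α : Type v} (f : α → D) :
    PreservesColimit (Discrete.functor f) G := by
  have := adj.right_adjoint_additive
  classical
  have hmono : Mono (sigmaComparison G f) := by
    rw [hP.mono_iff]
    have key (Z : C) (hZ : P Z) (t : Z ⟶ ∐ fun i ↦ G.obj (f i))
        (ht : t ≫ sigmaComparison G f = 0) : t = 0 := by
      obtain ⟨S, s, rfl⟩ := exists_eq_sum_of_isFinitelyPresentable Z (hfp Z hZ) _ t
      refine Finset.sum_eq_zero fun j _ ↦ ?_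
      -- The projections of the coproduct in `D`, available through zero morphisms, recover each
      -- component of `t`.
      have hj : (∑ i : S, s i ≫ Sigma.ι (fun i ↦ G.obj (f i)) i.1.as) ≫ sigmaComparison G f ≫
          G.map (Sigma.π f j.1.as) = s j := by
        rw [Preadditive.sum_comp, Finset.sum_eq_single j]
        · simp [← G.map_comp]
        · intro i _ hij
          have : i.1.as ≠ j.1.as := fun h ↦ hij (Subtype.ext (Discrete.ext h))
          simp [← G.map_comp, Sigma.ι_π_of_ne f this]
        · simp
      rw [← Category.assoc, ht, zero_comp] at hj
      rw [← hj, zero_comp]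
    intro Z hZ g h hgh
    rw [← sub_eq_zero]
    exact key Z hZ _ (by rw [Preadditive.sub_comp, hgh, sub_self])
  have hepi : Epi (sigmaComparison G f) := by
    refine ⟨fun u v huv ↦ hP _ _ fun Z hZ t ↦ ?_⟩
    -- The transpose `F Z ⟶ ∐ f` is a finite sum through summands; transposing back factors `t`
    -- through the comparison map.
    obtain ⟨S, s, hs⟩ := exists_eq_sum_of_isFinitelyPresentable _ (hFfp Z hZ) f
      ((adj.homEquiv _ _).symm t)
    have ht : t = (∑ i : S, adj.homEquiv _ _ (s i) ≫ Sigma.ι (fun i ↦ G.obj (f i)) i.1.as) ≫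
        sigmaComparison G f := by
      rw [← (adj.homEquiv _ _).apply_symm_apply t, hs, Preadditive.sum_comp,
        Adjunction.homEquiv_unit, G.map_sum, Preadditive.comp_sum]
      simp [Adjunction.homEquiv_unit]
    rw [ht, Category.assoc, Category.assoc, huv]
  have := isIso_of_mono_of_epi (sigmaComparison G f)
  exact PreservesCoproduct.of_iso_comparison G f

/-- Right exactness supplies coequalizers and finite presentability supplies coproducts; these
generate all colimits. -/
lemma preservesColimits_rightAdjoint {F : C ⥤ D} {G : D ⥤ C} [F.Additive]
    (adj : F ⊣ G) {P : ObjectProperty C} (hP : P.IsSeparating)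
    (hfp : ∀ Z, P Z → IsFinitelyPresentable.{v} Z)
    (hFfp : ∀ Z, P Z → IsFinitelyPresentable.{v} (F.obj Z)) [PreservesFiniteColimits G] :
    PreservesColimits G := by
  have (J : Type v) : PreservesColimitsOfShape (Discrete J) G :=
    have (f : J → D) := preservesCoproducts_of_isFinitelyPresentable adj hP hfp hFfp f
    preservesColimitsOfShape_of_discrete _
  exact preservesColimits_of_preservesCoequalizers_and_coproducts _

end FinitelyPresentable

/-! ### Finite limits and abelianness of the target -/

/-- A cocomplete category with a conservative, right exact right adjoint functor to a category
with finite limits has finite limits. -/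
lemma hasFiniteLimits_of_adjunction {C : Type u₁} [Category.{v} C] [HasFiniteLimits C]
    {D : Type u₂} [Category.{v} D] {F : C ⥤ D} {G : D ⥤ C} (adj : F ⊣ G) [HasColimits D]
    [G.ReflectsIsomorphisms] [PreservesFiniteColimits G] : HasFiniteLimits D := by
  have : Monad.PreservesColimitOfIsReflexivePair G := ⟨fun _ _ ↦ inferInstance⟩
  have := Monad.monadicOfHasPreservesReflexiveCoequalizersOfReflectsIsomorphisms adj
  have := monadicCreatesLimits.{0, 0} G
  exact ⟨fun J _ _ ↦ hasLimitsOfShape_of_hasLimitsOfShape_createsLimitsOfShape G⟩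

section Abelian

variable {C : Type u₁} [Category.{v} C] [Abelian C]
  {D : Type u₂} [Category.{v} D] [Preadditive D]

/-- The abelian category structure on a category which is abelian as a property. -/
@[reducible]
noncomputable def IsAbelianCat.toAbelian (h : IsAbelianCat D) : Abelian D :=
  { h with
    normalMonoOfMono := fun f ↦ h.normalMono.normalMonoOfMono f
    normalEpiOfEpi := fun f ↦ h.normalEpi.normalEpiOfEpi f
    has_kernels := h.hasKernels
    has_cokernels := h.hasCokernels
    has_finite_products := h.hasFiniteProducts }

/-- A finitely complete and cocomplete preadditive category with an exact conservative functor to an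
abelian category is abelian. -/
lemma isAbelianCat_of_reflectsIsomorphisms (G : D ⥤ C) [G.Additive] [HasFiniteLimits D]
    [HasFiniteColimits D] [G.ReflectsIsomorphisms] [PreservesFiniteColimits G]
    [PreservesFiniteLimits G] : IsAbelianCat D := by
  have (X Y : D) (f : X ⟶ Y) : IsIso (Abelian.coimageImageComparison f) := by
    -- The exact functor `G` carries the comparison to the one in `C`, which is invertible since `C`
    -- is abelian.
    have := IsIso.of_isIso_fac_right (Abelian.PreservesCoimage.hom_coimageImageComparison G f).symm
    exact isIso_of_reflects_iso _ G
  let : Abelian D := Abelian.ofCoimageImageComparisonIsIso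
  exact
    { normalMono := Abelian.toIsNormalMonoCategory
      normalEpi := Abelian.toIsNormalEpiCategory }

end Abelian

lemma rightAdjoint_linear (R : Type w) [CommRing R] {C : Type u₁} [Category.{v} C] [Preadditive C]
    [Linear R C] {D : Type u₂} [Category.{v} D] [Preadditive D] [Linear R D] {F : C ⥤ D}
    {G : D ⥤ C} [F.Additive] [F.Linear R] (adj : F ⊣ G) : G.Linear R where
  map_smul f r := by
    apply (adj.homEquiv _ _).symm.injective
    simp [Adjunction.homEquiv_counit]

/-! ### Objects with duals -/

section Duals

variable {C : Type u₁} [Category.{v} C] [MonoidalCategory C]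
  {D : Type u₂} [Category.{v} D] [MonoidalCategory D]

open Functor.LaxMonoidal Functor.OplaxMonoidal

/-- A strong monoidal functor preserves exact pairings. -/
@[reducible]
def exactPairingMap (F : C ⥤ D) [F.Monoidal] (X Y : C) [ExactPairing X Y] :
    ExactPairing (F.obj X) (F.obj Y) where
  coevaluation' := ε F ≫ F.map (η_ X Y) ≫ δ F X Y
  evaluation' := μ F Y X ≫ F.map (ε_ X Y) ≫ η F
  coevaluation_evaluation' := by
    have h := congr(μ F _ _ ≫ $(congr_arg F.map (ExactPairing.coevaluation_evaluation X Y)) ≫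
      δ F _ _ ≫ η F ▷ _)
    simp only [Functor.map_comp, Functor.Monoidal.map_whiskerLeft,
      Functor.Monoidal.map_whiskerRight, Functor.Monoidal.map_associator_inv,
      Functor.Monoidal.map_rightUnitor, Functor.Monoidal.map_leftUnitor_inv, Category.assoc,
      Functor.Monoidal.μ_δ_assoc,
      Functor.Monoidal.whiskerRight_ε_η, Category.comp_id] at h
    have h' := congr(F.obj Y ◁ ε F ≫ $h)
    simpa using h'
  evaluation_coevaluation' := by
    have h := congr(μ F _ _ ≫ $(congr_arg F.map (ExactPairing.evaluation_coevaluation X Y)) ≫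
      δ F _ _ ≫ _ ◁ η F)
    simp only [Functor.map_comp, Functor.Monoidal.map_whiskerLeft,
      Functor.Monoidal.map_whiskerRight, Functor.Monoidal.map_associator,
      Functor.Monoidal.map_leftUnitor, Functor.Monoidal.map_rightUnitor_inv, Category.assoc,
      Functor.Monoidal.μ_δ_assoc,
      Functor.Monoidal.whiskerLeft_ε_η, Category.comp_id] at h
    have h' := congr(ε F ▷ F.obj X ≫ $h)
    simpa using h'

lemma hasDual_map (F : C ⥤ D) [F.Monoidal] {X : C} (hX : hasDual C X) : hasDual D (F.obj X) := by
  obtain ⟨⟨Y, _⟩⟩ := hX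
  exact ⟨{ rightDual := F.obj Y, exact := exactPairingMap F X Y }⟩

end Duals

section Tensor
variable {R : Type w} [CommRing R] {C : Type u} [Category.{v} C] [Preadditive C] [Linear R C]
  [MonoidalCategory C]

lemma IsTensorCategory.hasColimits (h : IsTensorCategory R C) : HasColimits C :=
  h.locallyFinitelyPresentable.toHasColimitsOfSize

variable [SymmetricCategory C]

/-- Tensoring with `X` is left adjoint to tensoring with its dual, which is cocontinuous by
closedness; so it preserves finite presentability, in particular that of the unit. -/
lemma IsTensorCategory.isFinitelyPresentable_of_hasDual (h : IsTensorCategory R C) (X : C)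
    (hX : hasDual C X) : IsFinitelyPresentable.{v} X := by
  obtain ⟨⟨Y, _⟩⟩ := hX
  have := BraidedCategory.exactPairing_swap X Y
  have := h.unit_fp
  have := h.closed Y
  have : PreservesColimits (tensorLeft Y) :=
    (Adjunction.ofIsLeftAdjoint (tensorLeft Y)).leftAdjoint_preservesColimits
  have := Cardinal.fact_isRegular_aleph0
  have := (tensorLeftAdjunction Y X).isCardinalPresentable_leftAdjoint_obj Cardinal.aleph0 (𝟙_ C)
  have : IsCardinalPresentable (X ⊗ 𝟙_ C) Cardinal.aleph0 := this
  exact isCardinalPresentable_of_iso (ρ_ X) Cardinal.aleph0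

/-- Dualizable objects lie among the finitely presentable ones, so they have a small set of
representatives, indexed in the universe where coproducts exist. -/
lemma IsPregeometric.exists_family (h : IsPregeometric R C) :
    ∃ (ι : Type v) (Z : ι → C), (∀ i, hasDual C (Z i)) ∧
      (ObjectProperty.ofObj Z).IsSeparating := by
  have := h.locallyFinitelyPresentable
  have : ObjectProperty.EssentiallySmall.{v} (hasDual C) :=
    .of_le (Q := ObjectProperty.isFinitelyPresentable.{v} C)
      fun X hX ↦ h.toIsTensorCategory.isFinitelyPresentable_of_hasDual X hX
  obtain ⟨Q, hQ, hle, hle'⟩ := ObjectProperty.EssentiallySmall.exists_small_le (hasDual C)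
  refine ⟨Shrink.{v} (Subtype Q), fun i ↦ ((equivShrink _).symm i).1,
    fun i ↦ hle _ ((equivShrink _).symm i).2, fun X Y f g hfg ↦ h.generator _ _ fun Z hZ t ↦ ?_⟩
  obtain ⟨Z', hZ', ⟨e⟩⟩ := hle' _ hZ
  have := hfg Z' (by
    simpa using ObjectProperty.ofObj_apply (fun i ↦ ((equivShrink (Subtype Q)).symm i).1)
      (equivShrink _ ⟨Z', hZ'⟩)) (e.inv ≫ t)
  simpa using e.hom ≫= this

end Tensor

end GeomTensor

/-! ### Extending scalars to the value at the unit -/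

namespace GeomTensor

namespace LaxModule

open Functor.LaxMonoidal TensorProduct

variable {B : Type v} [CommRing B]

lemma map_comp_apply {D : Type u} [Category.{v} D] {L : D ⥤ ModuleCat.{v} B} {X Y Z : D}
    (f : X ⟶ Y) (g : Y ⟶ Z) (x : L.obj X) :
    (L.map g).hom ((L.map f).hom x) = (L.map (f ≫ g)).hom x := by
  rw [L.map_comp]; rfl

lemma map_id_apply {D : Type u} [Category.{v} D] {L : D ⥤ ModuleCat.{v} B} {X : D} (x : L.obj X) :
    (L.map (𝟙 X)).hom x = x := by
  rw [L.map_id]; rfl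

variable {D : Type u} [Category.{v} D] [MonoidalCategory D]

section Monoidal

variable (L : D ⥤ ModuleCat.{v} B) [L.LaxMonoidal]

/-- The external product on the values of a lax monoidal functor to modules. -/
def prod {X Y : D} : L.obj X →ₗ[B] L.obj Y →ₗ[B] L.obj (X ⊗ Y) :=
  TensorProduct.curry (μ L X Y).hom

/-- The unit element in the value of a lax monoidal functor at the unit object. -/
def unit : L.obj (𝟙_ D) := (ε L).hom (1 : B)

variable {L}

lemma ε_apply (b : B) : (ε L).hom b = b • unit L := by
  rw [unit, ← map_smul]
  exact congr_arg _ (mul_one b).symm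

lemma prod_map_left {X X' Y : D} (f : X ⟶ X') (x : L.obj X) (y : L.obj Y) :
    prod L ((L.map f).hom x) y = (L.map (f ▷ Y)).hom (prod L x y) :=
  congr($(μ_natural_left (F := L) f Y).hom (x ⊗ₜ[B] y))

lemma prod_map_right {X Y Y' : D} (f : Y ⟶ Y') (x : L.obj X) (y : L.obj Y) :
    prod L x ((L.map f).hom y) = (L.map (X ◁ f)).hom (prod L x y) :=
  congr($(μ_natural_right (F := L) X f).hom (x ⊗ₜ[B] y))

lemma prod_assoc {X Y Z : D} (x : L.obj X) (y : L.obj Y) (z : L.obj Z) :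
    (L.map (α_ X Y Z).hom).hom (prod L (prod L x y) z) = prod L x (prod L y z) :=
  congr($(associativity (F := L) X Y Z).hom ((x ⊗ₜ[B] y) ⊗ₜ[B] z))

lemma prod_assoc' {X Y Z : D} (x : L.obj X) (y : L.obj Y) (z : L.obj Z) :
    prod L (prod L x y) z = (L.map (α_ X Y Z).inv).hom (prod L x (prod L y z)) := by
  rw [← prod_assoc, map_comp_apply, Iso.hom_inv_id, map_id_apply]

lemma unit_prod {X : D} (x : L.obj X) : (L.map (λ_ X).hom).hom (prod L (unit L) x) = x := by
  have := congr($(left_unitality (F := L) X).hom ((1 : B) ⊗ₜ[B] x))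
  refine this.symm.trans (TensorProduct.lid_tmul x (1 : B)) |>.trans (one_smul _ _)

end Monoidal

variable [BraidedCategory D] (L : D ⥤ ModuleCat.{v} B) [L.LaxBraided]

variable {L} in
lemma prod_comm {X Y : D} (x : L.obj X) (y : L.obj Y) :
    (L.map (β_ X Y).hom).hom (prod L x y) = prod L y x :=
  congr($(Functor.LaxBraided.braided (F := L) X Y).hom (x ⊗ₜ[B] y))

/-- The action of the value at the unit on the value at an object. -/
def act (X : D) : L.obj (𝟙_ D) →ₗ[B] L.obj X →ₗ[B] L.obj X :=
  (LinearMap.compRight B (L.map (λ_ X).hom).hom).comp (prod L (X := 𝟙_ D) (Y := X))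

variable {L}

lemma act_apply {X : D} (s : L.obj (𝟙_ D)) (x : L.obj X) :
    act L X s x = (L.map (λ_ X).hom).hom (prod L s x) := rfl

lemma act_eq_prod {X : D} (s : L.obj (𝟙_ D)) (x : L.obj X) :
    act L X s x = (L.map (ρ_ X).hom).hom (prod L x s) := by
  rw [← prod_comm, map_comp_apply, braiding_rightUnitor, act_apply]

lemma act_unit {X : D} (x : L.obj X) : act L X (unit L) x = x := unit_prod x

lemma map_act {X Y : D} (f : X ⟶ Y) (s : L.obj (𝟙_ D)) (x : L.obj X) :
    (L.map f).hom (act L X s x) = act L Y s ((L.map f).hom x) := by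
  simp only [act_apply, prod_map_right, map_comp_apply, leftUnitor_naturality]

lemma act_prod {X Y : D} (s : L.obj (𝟙_ D)) (x : L.obj X) (y : L.obj Y) :
    prod L (act L X s x) y = act L (X ⊗ Y) s (prod L x y) := by
  rw [act_apply, act_apply, prod_map_left, prod_assoc', map_comp_apply]
  congr 3
  simp

lemma prod_act {X Y : D} (s : L.obj (𝟙_ D)) (x : L.obj X) (y : L.obj Y) :
    prod L x (act L Y s y) = act L (X ⊗ Y) s (prod L x y) := by
  rw [← prod_comm, act_prod, map_act, prod_comm]

lemma act_comm (s t : L.obj (𝟙_ D)) : act L (𝟙_ D) s t = act L (𝟙_ D) t s := by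
  rw [act_apply, act_apply, ← prod_comm s t, map_comp_apply, braiding_leftUnitor, unitors_equal]

lemma act_act {X : D} (s t : L.obj (𝟙_ D)) (x : L.obj X) :
    act L X s (act L X t x) = act L X (act L (𝟙_ D) s t) x := by
  rw [act_apply (act L (𝟙_ D) s t), act_prod, map_act]
  rfl

variable (L)

/-- The value of a lax braided functor to modules at the unit object. -/
def UnitRing : Type v := L.obj (𝟙_ D)

instance : AddCommGroup (UnitRing L) := inferInstanceAs (AddCommGroup (L.obj (𝟙_ D)))
instance : Module B (UnitRing L) := inferInstanceAs (Module B (L.obj (𝟙_ D)))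

/-- The unit object is a commutative algebra acting on every object through the unitors, and a lax
braided functor transports this structure. -/
instance : CommRing (UnitRing L) where
  __ := (inferInstance : AddCommGroup (UnitRing L))
  mul s t := act L (𝟙_ D) s t
  left_distrib s t t' := map_add (act L (𝟙_ D) s) t t'
  right_distrib s s' t := congr($(map_add (act L (𝟙_ D)) s s') t)
  zero_mul t := congr($(map_zero (act L (𝟙_ D))) t)
  mul_zero s := map_zero (act L (𝟙_ D) s)
  mul_assoc s t r := (act_act (L := L) s t r).symm
  one := unit L
  one_mul s := act_unit (L := L) s
  mul_one s := (act_comm (L := L) s (unit L)).trans (act_unit s)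
  mul_comm := act_comm (L := L)

instance (X : D) : Module (UnitRing L) (L.obj X) where
  smul s x := act L X s x
  one_smul x := act_unit x
  mul_smul s t x := (act_act (L := L) s t x).symm
  smul_zero s := map_zero (act L X s)
  zero_smul x := congr($(map_zero (act L X)) x)
  smul_add s := map_add (act L X s)
  add_smul s t x := congr($(map_add (act L X) s t) x)

instance : Algebra B (UnitRing L) :=
  Algebra.ofModule (fun b s t ↦ congr($(map_smul (act L (𝟙_ D)) b s) t))
    (fun b s t ↦ map_smul (act L (𝟙_ D) s) b t)

instance (X : D) : IsScalarTower B (UnitRing L) (L.obj X) where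
  smul_assoc b s x := congr($(map_smul (act L X) b s) x)

/-- A lax braided functor to modules lifts to modules over its value at the unit. -/
def lift : D ⥤ ModuleCat.{v} (UnitRing L) where
  obj X := ModuleCat.of (UnitRing L) (L.obj X)
  map {X Y} f := ModuleCat.ofHom (X := L.obj X) (Y := L.obj Y)
    { toFun := (L.map f).hom
      map_add' := map_add _
      map_smul' := fun s x ↦ map_act f s x }
  map_id X := by ext x; exact map_id_apply (L := L) x
  map_comp f g := by ext x; exact (map_comp_apply (L := L) f g x).symm

/-- The external product, over the value at the unit. -/
def liftProd (X Y : D) : L.obj X →ₗ[UnitRing L] L.obj Y →ₗ[UnitRing L] L.obj (X ⊗ Y) :=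
  LinearMap.mk₂ (UnitRing L) (fun x y ↦ prod L x y)
    (fun x x' y ↦ congr($(map_add (prod L) x x') y)) (fun s x y ↦ act_prod s x y)
    (fun x ↦ map_add (prod L x)) (fun s x y ↦ prod_act s x y)

instance : (lift L).LaxMonoidal where
  ε := ModuleCat.ofHom (X := UnitRing L) (Y := L.obj (𝟙_ D))
    { toFun := fun s ↦ s, map_add' := fun _ _ ↦ rfl, map_smul' := fun _ _ ↦ rfl }
  μ X Y := ModuleCat.ofHom (X := L.obj X ⊗[UnitRing L] L.obj Y) (Y := L.obj (X ⊗ Y))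
    (TensorProduct.lift (liftProd L X Y))
  μ_natural_left f Y := ModuleCat.MonoidalCategory.tensor_ext fun x y ↦ prod_map_left (L := L) f x y
  μ_natural_right X f := ModuleCat.MonoidalCategory.tensor_ext fun x y ↦ prod_map_right (L := L) f x y
  associativity X Y Z := ModuleCat.MonoidalCategory.tensor_ext₃' fun x y z ↦ prod_assoc (L := L) x y z
  left_unitality X := ModuleCat.MonoidalCategory.tensor_ext fun s x ↦
    TensorProduct.lid_tmul (R := UnitRing L) (M := L.obj X) x s
  right_unitality X := ModuleCat.MonoidalCategory.tensor_ext fun x s ↦ by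
    refine (TensorProduct.rid_tmul (R := UnitRing L) (M := L.obj X) x s).trans ?_
    exact act_eq_prod (L := L) s x

instance : (lift L).LaxBraided where
  braided _ _ := ModuleCat.MonoidalCategory.tensor_ext fun x y ↦ prod_comm (L := L) x y

/-- The unit comparison has become the identity of `UnitRing L`; this is the purpose of the change
of scalars. -/
instance : IsIso (ε (lift L)) := by
  refine (ConcreteCategory.isIso_iff_bijective _).2 Function.bijective_id

/-- The lift has the same underlying abelian groups. -/
def liftCompForget : lift L ⋙ forget₂ (ModuleCat.{v} (UnitRing L)) AddCommGrpCat.{v} ≅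
    L ⋙ forget₂ (ModuleCat.{v} B) AddCommGrpCat.{v} :=
  NatIso.ofComponents (fun _ ↦ Iso.refl _) (fun _ ↦ rfl)

/-- Colimits over either ring are tested on the common underlying abelian groups. -/
instance [PreservesColimits L] : PreservesColimits (lift L) := by
  have : PreservesColimits (lift L ⋙ forget₂ (ModuleCat.{v} (UnitRing L)) AddCommGrpCat.{v}) :=
    preservesColimits_of_natIso (liftCompForget L).symm
  have : ReflectsColimits (forget₂ (ModuleCat.{v} (UnitRing L)) AddCommGrpCat.{v}) :=
    reflectsColimits_of_reflectsIsomorphisms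
  exact preservesColimits_of_reflects_of_preserves _ (forget₂ _ AddCommGrpCat.{v})

instance [PreservesFiniteLimits L] : PreservesFiniteLimits (lift L) := by
  have : PreservesFiniteLimits (lift L ⋙ forget₂ (ModuleCat.{v} (UnitRing L)) AddCommGrpCat.{v}) :=
    preservesFiniteLimits_of_natIso (liftCompForget L).symm
  exact preservesFiniteLimits_of_reflects_of_preserves _ (forget₂ _ AddCommGrpCat.{v})

instance [L.Faithful] : (lift L).Faithful where
  map_injective {X Y f g} h := L.map_injective (by ext x; exact congr($(h).hom x))

end LaxModule

end GeomTensor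

/-! ### The projection formula at objects with duals -/

namespace GeomTensor

lemma leftUnitor_inv_coevaluation_evaluation {D : Type u} [Category.{v} D] [MonoidalCategory D]
    (X X' Y : D) [ExactPairing X X'] :
    (λ_ (X ⊗ Y)).inv ≫ η_ X X' ▷ (X ⊗ Y) ≫ (α_ X X' (X ⊗ Y)).hom ≫
      X ◁ ((α_ X' X Y).inv ≫ ε_ X X' ▷ Y ≫ (λ_ Y).hom) = 𝟙 _ := by
  calc
    _ = (λ_ X).inv ▷ Y ≫ (η_ X X' ▷ X ≫ (α_ X X' X).hom ≫ X ◁ ε_ X X') ▷ Y ≫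
        (ρ_ X).hom ▷ Y := by monoidal
    _ = _ := by rw [ExactPairing.evaluation_coevaluation]; monoidal

namespace LaxModule

open Functor.LaxMonoidal Functor.OplaxMonoidal TensorProduct

variable {B : Type v} [CommRing B] {C : Type u₁} [Category.{v} C] [MonoidalCategory C]
  {D : Type u₂} [Category.{v} D] [MonoidalCategory D]
  {F : C ⥤ D} [F.Monoidal] {W : C ⥤ ModuleCat.{v} B} [W.Monoidal] {L : D ⥤ ModuleCat.{v} B}

section Projection

variable [L.LaxMonoidal] (θ : W ⟶ F ⋙ L)

/-- The projection morphism attached to a monoidal transformation `W ⟶ F ⋙ L`. -/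
def projection (Z : C) (Y : D) : W.obj Z ⊗ L.obj Y ⟶ L.obj (F.obj Z ⊗ Y) :=
  θ.app Z ▷ L.obj Y ≫ μ L (F.obj Z) Y

omit [MonoidalCategory C] [F.Monoidal] [W.Monoidal] in
lemma projection_tmul {Z : C} {Y : D} (z : W.obj Z) (y : L.obj Y) :
    (projection θ Z Y).hom (z ⊗ₜ[B] y) = prod L ((θ.app Z).hom z) y := rfl

/-- The projection morphisms as a natural transformation in the first variable. -/
@[simps]
def projectionLeft (Y : D) : W ⋙ tensorRight (L.obj Y) ⟶ F ⋙ tensorRight Y ⋙ L where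
  app Z := projection θ Z Y
  naturality Z Z' f := by
    simp [projection, ← comp_whiskerRight_assoc]

/-- The projection morphisms as a natural transformation in the second variable. -/
@[simps]
def projectionRight (Z : C) : L ⋙ tensorLeft (W.obj Z) ⟶ tensorLeft (F.obj Z) ⋙ L where
  app Y := projection θ Z Y
  naturality Y Y' f := by
    simp [projection, whisker_exchange_assoc]

variable [NatTrans.IsMonoidal θ]

lemma app_tensor_apply {X Y : C} (x : W.obj X) (y : W.obj Y) :
    (θ.app (X ⊗ Y)).hom ((μ W X Y).hom (x ⊗ₜ[B] y)) =
      (L.map (μ F X Y)).hom (prod L ((θ.app X).hom x) ((θ.app Y).hom y)) :=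
  congr($(NatTrans.IsMonoidal.tensor (τ := θ) X Y).hom (x ⊗ₜ[B] y))

lemma app_unit_apply (b : B) :
    (θ.app (𝟙_ C)).hom ((ε W).hom b) = b • (L.map (ε F)).hom (unit L) := by
  rw [← map_smul, ← ε_apply]
  exact congr($(NatTrans.IsMonoidal.unit (τ := θ)).hom b)

omit [F.Monoidal] [L.LaxMonoidal] [W.Monoidal] [MonoidalCategory C] [MonoidalCategory D] in
lemma app_map_apply {X Y : C} (f : X ⟶ Y) (x : W.obj X) :
    (θ.app Y).hom ((W.map f).hom x) = (L.map (F.map f)).hom ((θ.app X).hom x) :=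
  congr($(θ.naturality f).hom x)

variable (Z Z' : C) [ExactPairing Z Z'] (Y : D)

/-- Contraction with the evaluation of the image of an exact pairing. -/
def contract : F.obj Z' ⊗ F.obj Z ⊗ Y ⟶ Y :=
  (α_ _ _ _).inv ≫ (μ F Z' Z ≫ F.map (ε_ Z Z') ≫ η F) ▷ Y ≫ (λ_ Y).hom

variable (F) in
lemma coevaluation_contract :
    (λ_ (F.obj Z ⊗ Y)).inv ≫ (ε F ≫ F.map (η_ Z Z') ≫ δ F Z Z') ▷ (F.obj Z ⊗ Y) ≫
      (α_ _ _ _).hom ≫ F.obj Z ◁ contract (F := F) Z Z' Y = 𝟙 _ := by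
  let := exactPairingMap F Z Z'
  exact leftUnitor_inv_coevaluation_evaluation (F.obj Z) (F.obj Z') Y

variable {Z Z' Y}

/-- The pairing of the values of a monoidal functor to modules on an exact pairing. -/
def pairing (e' : W.obj Z') (z : W.obj Z) : B :=
  (η W).hom ((W.map (ε_ Z Z')).hom ((μ W Z' Z).hom (e' ⊗ₜ[B] z)))

/-- As `θ` is monoidal, evaluating in `D` on images of `θ` is scalar multiplication by the pairing
computed in modules. -/
lemma map_contract (e' : W.obj Z') (z : W.obj Z) (y : L.obj Y) :
    (L.map (contract Z Z' Y)).hom (prod L ((θ.app Z').hom e') (prod L ((θ.app Z).hom z) y)) =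
      pairing e' z • y := by
  have h (w : W.obj (𝟙_ C)) : (ε W).hom ((η W).hom w) = w :=
    congr($(Functor.Monoidal.η_ε (F := W)).hom w)
  have key : (L.map (μ F Z' Z ≫ F.map (ε_ Z Z') ≫ η F)).hom
      (prod L ((θ.app Z').hom e') ((θ.app Z).hom z)) = pairing e' z • unit L := by
    rw [← map_comp_apply, ← map_comp_apply, ← app_tensor_apply, ← app_map_apply,
      ← h ((W.map _).hom _), app_unit_apply, map_smul, map_comp_apply, Functor.Monoidal.ε_η, map_id_apply]
    rfl
  rw [contract, ← map_comp_apply, ← prod_assoc', ← map_comp_apply, ← prod_map_left, key,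
    map_smul, LinearMap.smul_apply, map_smul, unit_prod]

/-- Contraction of an element with the image of the dual. -/
def contractElement (u : L.obj (F.obj Z ⊗ Y)) : W.obj Z' →ₗ[B] L.obj Y :=
  (L.map (contract Z Z' Y)).hom ∘ₗ (prod L).flip u ∘ₗ (θ.app Z').hom

/-- Taking `t` to be the coevaluation element turns the right side into a zigzag applied to `u`:
contraction is a right inverse of the projection. -/
lemma projection_contractElement (u : L.obj (F.obj Z ⊗ Y)) (t : W.obj Z ⊗[B] W.obj Z') :
    (projection θ Z Y).hom ((contractElement θ u).lTensor (W.obj Z) t) =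
      (L.map ((α_ _ _ _).hom ≫ F.obj Z ◁ contract Z Z' Y)).hom
        (prod L ((L.map (δ F Z Z')).hom ((θ.app (Z ⊗ Z')).hom ((μ W Z Z').hom t))) u) := by
  induction t with
  | zero => simp
  | add s t hs ht =>
    rw [map_add, map_add, hs, ht]
    simp only [map_add, LinearMap.add_apply]
  | tmul e e' =>
    rw [LinearMap.lTensor_tmul, projection_tmul, app_tensor_apply, map_comp_apply,
      Functor.Monoidal.μ_δ, map_id_apply, ← map_comp_apply, prod_assoc, ← prod_map_right]
    rfl

/-- For the coevaluation element `t` the right side is a zigzag in modules applied to `z`: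
contraction is a left inverse of the projection. -/
lemma contractElement_projection_tmul (z : W.obj Z) (y : L.obj Y) (t : W.obj Z ⊗[B] W.obj Z') :
    (contractElement θ ((projection θ Z Y).hom (z ⊗ₜ[B] y))).lTensor (W.obj Z) t =
      (LinearMap.toSpanSingleton B _ y).lTensor (W.obj Z)
        ((W.obj Z ◁ (μ W Z' Z ≫ W.map (ε_ Z Z') ≫ η W)).hom
          ((α_ (W.obj Z) (W.obj Z') (W.obj Z)).hom.hom (t ⊗ₜ[B] z))) := by
  induction t with
  | zero => simp
  | add s t hs ht => rw [map_add, hs, ht, add_tmul, map_add, map_add, map_add]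
  | tmul e e' =>
    exact congr_arg (e ⊗ₜ[B] ·) (map_contract θ e' z y)

/-- The projection morphism is an isomorphism at objects with duals. -/
lemma isIso_projection_of_hasDual (Z : C) (hZ : hasDual C Z) (Y : D) :
    IsIso (projection θ Z Y) := by
  obtain ⟨⟨Z', _⟩⟩ := hZ
  -- The coevaluation element `∑ eᵢ ⊗ eᵢ'`, a "dual basis"; the inverse sends `u` to `∑ eᵢ ⊗
  -- contract(eᵢ', u)`.
  let t : W.obj Z ⊗[B] W.obj Z' :=
    (δ W Z Z').hom ((W.map (η_ Z Z')).hom ((ε W).hom (1 : B)))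
  have ht : (μ W Z Z').hom t = (W.map (η_ Z Z')).hom ((ε W).hom (1 : B)) :=
    congr($(Functor.Monoidal.δ_μ (F := W) Z Z').hom _)
  refine (ConcreteCategory.isIso_iff_bijective _).2 ⟨?_, fun u ↦ ?_⟩
  · have key (w : W.obj Z ⊗[B] L.obj Y) :
        (contractElement θ ((projection θ Z Y).hom w)).lTensor (W.obj Z) t = w := by
      induction w with
      | zero =>
        have : contractElement θ ((projection θ Z Y).hom 0) (Z' := Z') = 0 := by
          ext; simp [contractElement]
        rw [this, LinearMap.lTensor_zero, LinearMap.zero_apply]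
      | add w w' hw hw' =>
        have : contractElement θ ((projection θ Z Y).hom (w + w')) (Z' := Z') =
            contractElement θ ((projection θ Z Y).hom w) +
              contractElement θ ((projection θ Z Y).hom w') := by
          ext; simp [contractElement]
        rw [this, LinearMap.lTensor_add, LinearMap.add_apply, hw, hw']
      | tmul z y =>
        rw [contractElement_projection_tmul]
        let := exactPairingMap W Z Z'
        have := congr($(ExactPairing.evaluation_coevaluation (W.obj Z) (W.obj Z')).hom
          ((1 : B) ⊗ₜ[B] z))
        refine (congr_arg ((LinearMap.toSpanSingleton B _ y).lTensor (W.obj Z)) this).trans ?_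
        change (LinearMap.toSpanSingleton B _ y).lTensor (W.obj Z) (((1 : B) • z) ⊗ₜ[B] (1 : B)) = _
        simp
    intro w w' h
    rw [← key w, ← key w']
    exact congr_arg (fun a ↦ (contractElement θ a).lTensor (W.obj Z) t) h
  · refine ⟨(contractElement θ u).lTensor (W.obj Z) t, ?_⟩
    refine (projection_contractElement θ u t).trans ?_
    rw [ht, app_map_apply, app_unit_apply, one_smul, map_comp_apply, map_comp_apply,
      prod_map_left, map_comp_apply]
    have hu : (L.map (λ_ _).inv).hom u = prod L (unit L) u := by
      rw [← unit_prod u, map_comp_apply, Iso.hom_inv_id, map_id_apply, unit_prod]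
    rw [← hu, map_comp_apply]
    have := coevaluation_contract F Z Z' Y
    rw [this, map_id_apply]

end Projection

end LaxModule

end GeomTensor

/-! ### Strong monoidality of the lift -/

namespace GeomTensor

lemma preservesColimits_tensorRight {D : Type u} [Category.{v} D] [MonoidalCategory D]
    [BraidedCategory D] (Y : D) [(tensorLeft Y).IsLeftAdjoint] :
    PreservesColimits (tensorRight Y) := by
  have : PreservesColimits (tensorLeft Y) :=
    (Adjunction.ofIsLeftAdjoint (tensorLeft Y)).leftAdjoint_preservesColimits
  exact preservesColimits_of_natIso (BraidedCategory.tensorLeftIsoTensorRight Y)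

namespace LaxModule

open Functor.LaxMonoidal Functor.OplaxMonoidal TensorProduct

variable {B : Type v} [CommRing B] {C : Type u₁} [Category.{v} C] [MonoidalCategory C]
  {D : Type u₂} [Category.{v} D] [MonoidalCategory D] [BraidedCategory D]
  {F : C ⥤ D} [F.Monoidal] {W : C ⥤ ModuleCat.{v} B} [W.Monoidal] {L : D ⥤ ModuleCat.{v} B}
  [L.LaxBraided] (θ : W ⟶ F ⋙ L)

/-- The projection morphisms are isomorphisms if objects with duals separate. -/
lemma isIso_projection [Abelian C] [HasColimits C] {ι : Type v} (Z : ι → C)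
    (hZ : ∀ i, hasDual C (Z i)) (hsep : (ObjectProperty.ofObj Z).IsSeparating)
    [NatTrans.IsMonoidal θ] [PreservesColimits F] [PreservesColimits W] [PreservesColimits L]
    (Y : D) [(tensorLeft Y).IsLeftAdjoint] (X : C) : IsIso (projection θ X Y) := by
  have := preservesColimits_tensorRight Y
  have := preservesColimits_tensorRight (L.obj Y)
  exact isIso_app_of_isSeparating Z hsep (projectionLeft θ Y)
    (fun i ↦ isIso_projection_of_hasDual θ (Z i) (hZ i) Y) X

omit [MonoidalCategory C] [F.Monoidal] [W.Monoidal] in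
/-- The structure morphisms of the lift are bijective where the projection morphisms are so. -/
lemma isIso_lift_μ_of_isIso_projection (Z : C) (Y : D) [IsIso (projection θ Z Y)]
    [IsIso (projection θ Z (𝟙_ D))] : IsIso (μ (lift L) (F.obj Z) Y) := by
  let g (z : W.obj Z) : L.obj (F.obj Z) := (θ.app Z).hom z
  have hg (b : B) (z : W.obj Z) : g (b • z) = b • g z := map_smul (θ.app Z).hom b z
  -- The projection factors as `ψ` followed by the structure map. It is bijective, so surjectivity
  -- of `ψ` suffices.
  let ψ : W.obj Z ⊗[B] L.obj Y →+ L.obj (F.obj Z) ⊗[UnitRing L] L.obj Y :=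
    TensorProduct.liftAddHom
      { toFun := fun z ↦
          { toFun := fun y ↦ g z ⊗ₜ y
            map_zero' := tmul_zero _ _
            map_add' := tmul_add _ }
        map_zero' := by ext; simp [g]
        map_add' := fun z z' ↦ by ext; simp [g, add_tmul] }
      (fun b z y ↦ by
        change g (b • z) ⊗ₜ[UnitRing L] y = g z ⊗ₜ[UnitRing L] (b • y)
        rw [hg, ← algebraMap_smul (UnitRing L), smul_tmul, algebraMap_smul])
  have hψ (w : W.obj Z ⊗[B] L.obj Y) :
      (μ (lift L) (F.obj Z) Y).hom (ψ w) = (projection θ Z Y).hom w := by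
    induction w with
    | zero => rw [map_zero]; exact (map_zero _).trans (map_zero _).symm
    | add w w' h h' =>
      rw [map_add]
      exact (map_add _ _ _).trans ((congr_arg₂ (· + ·) h h').trans (map_add _ _ _).symm)
    | tmul z y => rfl
  have hsurj : Function.Surjective ψ := by
    -- The projection at the unit shows that `L(F Z)` is spanned by products `s • g z`; the scalar
    -- `s` moves across the tensor onto `y`.
    have h1 (w : W.obj Z ⊗[B] L.obj (𝟙_ D)) (y : L.obj Y) :
        ((L.map (ρ_ _).hom).hom ((projection θ Z (𝟙_ D)).hom w)) ⊗ₜ[UnitRing L] y ∈ ψ.range := by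
      induction w with
      | zero => rw [map_zero, map_zero, zero_tmul]; exact zero_mem _
      | add w w' h h' =>
        have := add_mem h h'
        rw [← add_tmul, ← map_add] at this
        rw [map_add]
        exact this
      | tmul z s =>
        refine ⟨z ⊗ₜ[B] act L Y s y, ?_⟩
        rw [projection_tmul, ← act_eq_prod]
        exact (smul_tmul (R := UnitRing L) (R' := UnitRing L) (show UnitRing L from s) (g z) y).symm
    have h2 : Function.Surjective (projection θ Z (𝟙_ D)).hom :=
      ((ConcreteCategory.isIso_iff_bijective _).1 inferInstance).2
    have h3 (w : L.obj (F.obj Z) ⊗[UnitRing L] L.obj Y) : w ∈ ψ.range := by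
      induction w with
      | zero => exact zero_mem _
      | add w w' h h' => exact add_mem h h'
      | tmul x y =>
        obtain ⟨w, hw⟩ := h2 ((L.map (ρ_ _).inv).hom x)
        have := h1 w y
        rwa [hw, map_comp_apply, Iso.inv_hom_id, map_id_apply] at this
    exact h3
  have hbij : Function.Bijective (projection θ Z Y).hom :=
    (ConcreteCategory.isIso_iff_bijective _).1 inferInstance
  refine (ConcreteCategory.isIso_iff_bijective _).2 ⟨fun a b h ↦ ?_, fun x ↦ ?_⟩
  · obtain ⟨a, rfl⟩ := hsurj a
    obtain ⟨b, rfl⟩ := hsurj b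
    exact congr_arg ψ (hbij.1 ((hψ a).symm.trans (h.trans (hψ b))))
  · obtain ⟨w, rfl⟩ := hbij.2 x
    exact ⟨ψ w, hψ w⟩

/-- The structure morphisms of the lift as a natural transformation in the first variable. -/
@[simps]
def liftμLeft (L : D ⥤ ModuleCat.{v} B) [L.LaxBraided] (Y : D) :
    lift L ⋙ tensorRight ((lift L).obj Y) ⟶ tensorRight Y ⋙ lift L where
  app X := μ (lift L) X Y

/-- The lift is strong monoidal if the projection morphisms are isomorphisms and the image of `F`
separates. -/
lemma isIso_lift_μ [Abelian D] [HasColimits D] {ι : Type v} (Z : ι → C)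
    (hsep : (ObjectProperty.ofObj fun i ↦ F.obj (Z i)).IsSeparating) [PreservesColimits L]
    (hL : ∀ i Y, IsIso (projection θ (Z i) Y)) (hD : ∀ Y : D, (tensorLeft Y).IsLeftAdjoint)
    (X Y : D) : IsIso (μ (lift L) X Y) := by
  have := preservesColimits_tensorRight Y
  have := preservesColimits_tensorRight ((lift L).obj Y)
  exact isIso_app_of_isSeparating _ hsep (liftμLeft L Y)
    (fun i ↦ isIso_lift_μ_of_isIso_projection θ (Z i) Y) X

end LaxModule

end GeomTensor

/-! ### Affine algebras in terms of elements -/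

namespace GeomTensor

section Affine

open scoped MonObj

variable {C : Type u₁} [Category.{v} C] [MonoidalCategory C] {A : C} [MonObj A]

section Element

variable {X : C} {a : A ⊗ X ⟶ X}

/-- Together with `one_elementHom` and `elementHom_one`: the regular module is free on the unit, an
element `x` corresponding to the linear map `a ↦ a x`. -/
lemma mul_elementHom (ha : μ[A] ▷ X ≫ a = (α_ A A X).hom ≫ A ◁ a ≫ a) (x : 𝟙_ C ⟶ X) :
    μ[A] ≫ (ρ_ A).inv ≫ A ◁ x ≫ a = A ◁ ((ρ_ A).inv ≫ A ◁ x ≫ a) ≫ a := by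
  calc
    _ = (ρ_ (A ⊗ A)).inv ≫ (A ⊗ A) ◁ x ≫ μ[A] ▷ X ≫ a := by
      rw [whisker_exchange_assoc, rightUnitor_inv_naturality_assoc]
    _ = _ := by
      rw [ha]
      simp

lemma one_elementHom (ha : η[A] ▷ X ≫ a = (λ_ X).hom) (x : 𝟙_ C ⟶ X) :
    η[A] ≫ (ρ_ A).inv ≫ A ◁ x ≫ a = x := by
  rw [rightUnitor_inv_naturality_assoc, ← whisker_exchange_assoc, ha,
    leftUnitor_naturality, ← unitors_inv_equal, Iso.inv_hom_id_assoc]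

lemma elementHom_one {f : A ⟶ X} (h : μ[A] ≫ f = A ◁ f ≫ a) :
    (ρ_ A).inv ≫ A ◁ (η[A] ≫ f) ≫ a = f := by
  rw [MonoidalCategory.whiskerLeft_comp, Category.assoc, ← h, MonObj.mul_one_assoc,
    Iso.inv_hom_id_assoc]

end Element

/-- The action of a monoid on a module over it. -/
def modAct (M : Mod C A) : A ⊗ M.X ⟶ M.X := ModObj.smul (M := A) (X := M.X)

lemma one_modAct (M : Mod C A) : η[A] ▷ M.X ≫ modAct M = (λ_ M.X).hom :=
  ModObj.one_smul (M := A) M.X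

lemma mul_modAct (M : Mod C A) :
    μ[A] ▷ M.X ≫ modAct M = (α_ A A M.X).hom ≫ A ◁ modAct M ≫ modAct M :=
  ModObj.mul_smul (M := A) M.X

/-- A morphism of modules, with the compatibility stated by the tensor product. -/
def modHomMk {M N : Mod C A} (f : M.X ⟶ N.X) (h : modAct M ≫ f = A ◁ f ≫ modAct N) : M ⟶ N :=
  Mod.Hom.mk' f h

lemma modHom_smul {M N : Mod C A} (f : M ⟶ N) : modAct M ≫ f.hom = A ◁ f.hom ≫ modAct N :=
  IsModHom.smul_hom (A := A) (f := f.hom)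

lemma modHom_smul_assoc {M N : Mod C A} (f : M ⟶ N) {T : C} (t : N.X ⟶ T) :
    modAct M ≫ f.hom ≫ t = A ◁ f.hom ≫ modAct N ≫ t := by
  rw [← Category.assoc, modHom_smul, Category.assoc]

/-- The morphism from the regular module given by an element. -/
def ofElement {M : Mod C A} (x : 𝟙_ C ⟶ M.X) : Mod.regular A ⟶ M :=
  modHomMk (M := Mod.regular A) ((ρ_ A).inv ≫ A ◁ x ≫ modAct M) (mul_elementHom (mul_modAct M) x)

lemma ofElement_comp {M N : Mod C A} (x : 𝟙_ C ⟶ M.X) (f : M ⟶ N) :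
    ofElement x ≫ f = ofElement (x ≫ f.hom) := by
  ext
  change ((ρ_ A).inv ≫ A ◁ x ≫ modAct M) ≫ f.hom = (ρ_ A).inv ≫ A ◁ (x ≫ f.hom) ≫ modAct N
  simp [modHom_smul f]

/-- The element given by a morphism from the regular module. -/
def toElement {M : Mod C A} (f : Mod.regular A ⟶ M) : 𝟙_ C ⟶ M.X :=
  η[A] ≫ (show A ⟶ M.X from f.hom)

lemma toElement_comp {M N : Mod C A} (f : Mod.regular A ⟶ M) (g : M ⟶ N) :
    toElement (f ≫ g) = toElement f ≫ g.hom :=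
  (Category.assoc _ _ _).symm

lemma toElement_ofElement {M : Mod C A} (x : 𝟙_ C ⟶ M.X) : toElement (ofElement x) = x :=
  one_elementHom (one_modAct M) x

lemma ofElement_toElement {M : Mod C A} (f : Mod.regular A ⟶ M) :
    ofElement (toElement f) = f := by
  ext
  exact elementHom_one (A := A) (X := M.X) (f := f.hom) (modHom_smul f)

/-- Affineness in terms of elements. -/
lemma isAffineAlgebra_iff : IsAffineAlgebra A ↔
    (∀ ⦃M N : Mod C A⦄ (e : M ⟶ N), Epi e → ∀ y : 𝟙_ C ⟶ N.X, ∃ x : 𝟙_ C ⟶ M.X, x ≫ e.hom = y) ∧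
    (∀ ⦃M N : Mod C A⦄ (f g : M ⟶ N), (∀ x : 𝟙_ C ⟶ M.X, x ≫ f.hom = x ≫ g.hom) → f = g) := by
  refine ⟨fun ⟨hp, hs⟩ ↦ ⟨fun M N e _ y ↦ ?_, fun M N f g h ↦ ?_⟩, fun ⟨h₁, h₂⟩ ↦ ⟨⟨?_⟩, ?_⟩⟩
  · refine ⟨toElement (Projective.factorThru (ofElement y) e), ?_⟩
    rw [← toElement_comp, Projective.factorThru_comp, toElement_ofElement]
  · refine hs.def _ _ fun t ↦ ?_
    rw [← ofElement_toElement t, ofElement_comp, ofElement_comp, h]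
  · intro M N f e he
    obtain ⟨x, hx⟩ := h₁ e he (toElement f)
    exact ⟨ofElement x, by rw [ofElement_comp, hx, ofElement_toElement]⟩
  · rw [isSeparator_def]
    intro M N f g h
    refine h₂ f g fun x ↦ ?_
    have := congr_arg toElement (h (ofElement x))
    rwa [toElement_comp, toElement_comp, toElement_ofElement] at this

/-- Epimorphisms of modules are epimorphisms in the ambient category. -/
lemma epi_hom_of_epi [Preadditive C] [MonoidalPreadditive C] [HasCokernels C]
    [(tensorLeft A).IsLeftAdjoint] {M N : Mod C A} (e : M ⟶ N) [Epi e] : Epi e.hom := by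
  have : PreservesColimits (tensorLeft A) :=
    (Adjunction.ofIsLeftAdjoint (tensorLeft A)).leftAdjoint_preservesColimits
  let q : N.X ⟶ cokernel e.hom := cokernel.π e.hom
  have hq : e.hom ≫ q = 0 := cokernel.condition _
  have hepi {X Y : C} (p : X ⟶ Y) [Epi p] : Epi (A ◁ p) :=
    inferInstanceAs (Epi ((tensorLeft A).map p))
  have hw : A ◁ e.hom ≫ modAct N ≫ q = 0 := by
    rw [← modHom_smul_assoc e, hq, comp_zero]
  -- Since `A ⊗ -` preserves cokernels, the action on `N` descends to the cokernel, which becomes a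
  -- module.
  obtain ⟨a, ha⟩ : ∃ a : A ⊗ cokernel e.hom ⟶ cokernel e.hom, A ◁ q ≫ a = modAct N ≫ q :=
    have hc := CokernelCofork.mapIsColimit _ (cokernelIsCokernel e.hom) (tensorLeft A)
    ⟨hc.desc (CokernelCofork.ofπ _ hw), hc.fac _ .one⟩
  let Q : Mod C A :=
    { X := cokernel e.hom
      mod :=
        { smul := a
          one_smul := by
            change η[A] ▷ _ ≫ a = (λ_ _).hom
            have : Epi (𝟙_ C ◁ q) := by
              rw [id_whiskerLeft]
              infer_instance
            rw [← cancel_epi (𝟙_ C ◁ q), whisker_exchange_assoc, ha, ← Category.assoc, one_modAct,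
              leftUnitor_naturality]
          mul_smul := by
            change μ[A] ▷ _ ≫ a = (α_ A A _).hom ≫ A ◁ a ≫ a
            have : Epi ((A ⊗ A) ◁ q) := by
              have := hepi (A ◁ q)
              rw [tensor_whiskerLeft]
              infer_instance
            rw [← cancel_epi ((A ⊗ A) ◁ q), whisker_exchange_assoc, ha, ← Category.assoc,
              mul_modAct]
            simp [← MonoidalCategory.whiskerLeft_comp_assoc, ha] } }
  let q' : N ⟶ Q := modHomMk q ha.symm
  let z : N ⟶ Q := modHomMk 0 (by simp)
  -- The quotient map and zero are both linear and agree after `e`, so the cokernel projection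
  -- vanishes.
  have h : e ≫ q' = e ≫ z := by
    ext
    exact hq.trans comp_zero.symm
  have hq0 : cokernel.π e.hom = 0 := congr_arg Mod.Hom.hom ((cancel_epi e).1 h)
  exact Preadditive.epi_of_cokernel_zero hq0

end Affine

/-! ### Transfer of modules and affineness along the adjunction -/

section Transfer

open Functor.LaxMonoidal

variable {C : Type u₁} [Category.{v} C] [MonoidalCategory C]
  {D : Type u₂} [Category.{v} D] [MonoidalCategory D]

/-- The functor induced on modules by a lax monoidal functor. -/
def mapMod (G : D ⥤ C) [G.LaxMonoidal] (N : D) [MonObj N] : Mod D N ⥤ Mod C (G.obj N) where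
  obj M :=
    { X := G.obj M.X
      mod :=
        { smul := μ G N M.X ≫ G.map (modAct M)
          one_smul := by
            change (ε G ≫ G.map MonObj.one) ▷ G.obj M.X ≫ μ G N M.X ≫ G.map (modAct M) =
              (λ_ (G.obj M.X)).hom
            rw [comp_whiskerRight, Category.assoc, μ_natural_left_assoc, ← G.map_comp, one_modAct,
              ← left_unitality]
          mul_smul := by
            change (μ G N N ≫ G.map MonObj.mul) ▷ G.obj M.X ≫ μ G N M.X ≫ G.map (modAct M) =
              (α_ _ _ _).hom ≫ G.obj N ◁ (μ G N M.X ≫ G.map (modAct M)) ≫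
                μ G N M.X ≫ G.map (modAct M)
            rw [comp_whiskerRight, Category.assoc, μ_natural_left_assoc, ← G.map_comp, mul_modAct,
              G.map_comp, associativity_assoc, MonoidalCategory.whiskerLeft_comp, Category.assoc,
              μ_natural_right_assoc, G.map_comp] } }
  map {M M'} f := modHomMk (G.map f.hom) <| by
    change (μ G N M.X ≫ G.map (modAct M)) ≫ G.map f.hom =
      G.obj N ◁ G.map f.hom ≫ μ G N M'.X ≫ G.map (modAct M')
    rw [Category.assoc, ← G.map_comp, modHom_smul, G.map_comp, μ_natural_right_assoc]
  map_id M := by ext; exact G.map_id _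
  map_comp f g := by ext; exact G.map_comp _ _

variable {F : C ⥤ D} [F.Monoidal] {G : D ⥤ C} [G.LaxMonoidal]

lemma isMonHom_unit_app (adj : F ⊣ G) [adj.IsMonoidal] (A : C) [MonObj A] :
    IsMonHom (M := A) (N := G.obj (F.obj A)) (adj.unit.app A) where
  one_hom := by
    have h := NatTrans.IsMonoidal.unit (τ := adj.unit)
    have h' := adj.unit.naturality (MonObj.one : 𝟙_ C ⟶ A)
    simp only [Functor.LaxMonoidal.id_ε, Functor.LaxMonoidal.comp_ε, Category.id_comp,
      Functor.id_map, Functor.comp_map] at h h'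
    simp [h', h]
  mul_hom := by
    have h := NatTrans.IsMonoidal.tensor (τ := adj.unit) A A
    have h' := adj.unit.naturality (MonObj.mul : A ⊗ A ⟶ A)
    simp only [Functor.LaxMonoidal.id_μ, Functor.LaxMonoidal.comp_μ, Category.id_comp,
      Functor.id_map, Functor.comp_map] at h h'
    simp [h', h]

/-- The functor from `F A`-modules to `A`-modules induced by the right adjoint of `F`. -/
def modRightAdjoint (adj : F ⊣ G) [adj.IsMonoidal] (A : C) [MonObj A] :
    Mod D (F.obj A) ⥤ Mod C A :=
  have := isMonHom_unit_app adj A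
  mapMod G (F.obj A) ⋙ Mod.comap (adj.unit.app A)

/-- The image of an affine algebra is affine, if the right adjoint is faithful and preserves
epimorphisms. -/
lemma isAffineAlgebra_map (adj : F ⊣ G) [adj.IsMonoidal] (A : C) [MonObj A] [Preadditive D]
    [MonoidalPreadditive D] [HasCokernels D] (hD : ∀ X : D, (tensorLeft X).IsLeftAdjoint)
    [G.Faithful] [G.PreservesEpimorphisms]
    (hA : IsAffineAlgebra A) : IsAffineAlgebra (F.obj A) := by
  obtain ⟨h₁, h₂⟩ := isAffineAlgebra_iff.1 hA
  -- Elements of `X` and of `G X` correspond by adjunction, through `F 𝟙 ≅ 𝟙`.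
  let t {X : D} (x : 𝟙_ D ⟶ X) : 𝟙_ C ⟶ G.obj X := ε G ≫ G.map x
  have ht {X : D} : Function.Bijective (t (X := X)) := by
    have h : t (X := X) = adj.homEquiv _ _ ∘ fun x ↦ Functor.OplaxMonoidal.η F ≫ x := by
      ext x
      simp [t, Adjunction.homEquiv_unit, Adjunction.IsMonoidal.leftAdjoint_ε (adj := adj)]
    rw [h]
    exact (adj.homEquiv _ _).bijective.comp (Functor.Monoidal.εIso F).homFromEquiv.bijective
  refine isAffineAlgebra_iff.2 ⟨fun M N e _ y ↦ ?_, fun M N f g h ↦ ?_⟩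
  · have := hD (F.obj A)
    have := epi_hom_of_epi e
    have : Epi ((modRightAdjoint adj A).map e) :=
      have : (Mod.forget (D := C) A).Faithful := ⟨fun h ↦ Mod.hom_ext _ _ h⟩
      (Mod.forget A).epi_of_epi_map (inferInstanceAs (Epi (G.map e.hom)))
    obtain ⟨x, hx⟩ := h₁ ((modRightAdjoint adj A).map e) this (t y)
    obtain ⟨x, rfl⟩ := ht.2 x
    refine ⟨x, ht.1 (Eq.trans ?_ hx)⟩
    exact (congr_arg (ε G ≫ ·) (G.map_comp x e.hom)).trans (Category.assoc _ _ _).symm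
  · have key := h₂ ((modRightAdjoint adj A).map f) ((modRightAdjoint adj A).map g) fun x ↦ by
      obtain ⟨x, rfl⟩ := ht (X := M.X) |>.2 x
      have := congr_arg t (h x)
      simp only [t, G.map_comp, ← Category.assoc] at this
      exact this
    ext
    exact G.map_injective (congr_arg Mod.Hom.hom key)

end Transfer

end GeomTensor

/-! ### Assembling the covering and the theorem -/

namespace GeomTensor

/-- Maps `F (Z i) ⟶ X` are transposes of maps `Z i ⟶ G X`, and the faithful `G` detects equality. -/
lemma isSeparating_map {C : Type u₁} [Category.{v} C] {D : Type u₂} [Category.{v} D] {F : C ⥤ D}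
    {G : D ⥤ C} (adj : F ⊣ G) [G.Faithful] {ι : Type v} (Z : ι → C)
    (hZ : (ObjectProperty.ofObj Z).IsSeparating) :
    (ObjectProperty.ofObj fun i ↦ F.obj (Z i)).IsSeparating := by
  intro X Y f g h
  refine G.map_injective (hZ _ _ ?_)
  rintro _ ⟨i⟩ t
  apply (adj.homEquiv _ _).symm.injective
  simpa [Adjunction.homEquiv_counit] using
    h _ (ObjectProperty.ofObj_apply (fun i ↦ F.obj (Z i)) i) ((adj.homEquiv _ _).symm t)

section Adjunctions

open Functor.LaxMonoidal Functor.OplaxMonoidal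

variable {C : Type u₁} [Category.{v} C] [MonoidalCategory C]
  {D : Type u₂} [Category.{v} D] [MonoidalCategory D]

/-- The right adjoint of a braided functor is lax braided. -/
@[reducible]
def rightAdjointLaxBraided [BraidedCategory C] [BraidedCategory D] {F : C ⥤ D} [F.Braided]
    {G : D ⥤ C} [G.LaxMonoidal] (adj : F ⊣ G) [adj.IsMonoidal] : G.LaxBraided where
  braided X Y := by
    simp only [Adjunction.IsMonoidal.leftAdjoint_μ (adj := adj)]
    apply (adj.homEquiv _ _).symm.injective
    simp [Adjunction.homEquiv_counit, BraidedCategory.braiding_naturality]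

lemma isMonoidal_whiskerRight_unit {F : C ⥤ D} [F.Monoidal] {G : D ⥤ C} [G.LaxMonoidal]
    (adj : F ⊣ G) [adj.IsMonoidal] {E : Type u} [Category.{w} E] [MonoidalCategory E] (W : C ⥤ E)
    [W.LaxMonoidal] :
    NatTrans.IsMonoidal (F₁ := W) (F₂ := F ⋙ G ⋙ W) (Functor.whiskerRight adj.unit W) := by
  constructor
  · have := NatTrans.IsMonoidal.unit (τ := adj.unit)
    simp only [Functor.LaxMonoidal.comp_ε, Functor.LaxMonoidal.id_ε, Category.id_comp,
      Functor.id_obj] at this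
    change ε W ≫ W.map (adj.unit.app (𝟙_ C)) = _
    simp [this]
  · intro X Y
    have := NatTrans.IsMonoidal.tensor (τ := adj.unit) X Y
    simp at this
    simp [this]

end Adjunctions

section Covering

open scoped ModuleCat.Algebra

open Functor.LaxMonoidal LaxModule

variable {R : Type w} [CommRing R] {B : Type v} [CommRing B] [Algebra R B]

/-- The structure of an algebra over the base ring. -/
@[reducible]
noncomputable def LaxModule.unitRingAlgebra {D : Type u} [Category.{v} D] [MonoidalCategory D]
    [BraidedCategory D] (L : D ⥤ ModuleCat.{v} B) [L.LaxBraided] : Algebra R (UnitRing L) :=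
  ((algebraMap B (UnitRing L)).comp (algebraMap R B)).toAlgebra

lemma LaxModule.lift_linear {D : Type u} [Category.{v} D] [Preadditive D] [Linear R D]
    [MonoidalCategory D] [BraidedCategory D] (L : D ⥤ ModuleCat.{v} B) [L.LaxBraided]
    [L.Linear R] :
    letI : Algebra R (UnitRing L) := unitRingAlgebra L
    (lift L).Linear R := by
  let : Algebra R (UnitRing L) := unitRingAlgebra L
  constructor
  intro X Y f r
  ext x
  have h : (L.map (r • f)).hom x = algebraMap R B r • (L.map f).hom x := by
    rw [L.map_smul]; rfl
  refine h.trans ?_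
  exact (algebraMap_smul (UnitRing L) (algebraMap R B r) ((L.map f).hom x)).symm

lemma LaxModule.lift_additive {D : Type u} [Category.{v} D] [Preadditive D]
    [MonoidalCategory D] [BraidedCategory D] (L : D ⥤ ModuleCat.{v} B) [L.LaxBraided]
    [L.Additive] : (lift L).Additive where
  map_add {X Y f g} := by
    ext x
    exact congr($(L.map_add (f := f) (g := g)).hom x)

end Covering

section Main

open scoped ModuleCat.Algebra
open Functor.LaxMonoidal LaxModule

variable {R : Type w} [CommRing R]
    {C : Type u₁} [Category.{v} C] [Preadditive C] [Linear R C] [MonoidalCategory C]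
    [SymmetricCategory C]
    {D : Type u₂} [Category.{v} D] [Preadditive D] [Linear R D] [MonoidalCategory D]

/-- A cocontinuous functor on a cocomplete abelian category with a small separating family is
a left adjoint. -/
lemma isLeftAdjoint_of_isSeparating {D : Type u₂} [Category.{v} D] [Abelian D] [HasColimits D]
    {E : Type u} [Category.{v} E] {ι : Type v} {Z : ι → D}
    (hZ : (ObjectProperty.ofObj Z).IsSeparating) (H : D ⥤ E) [PreservesColimits H] :
    H.IsLeftAdjoint := by
  -- The special adjoint functor theorem needs well-poweredness, which a small detecting family
  -- provides.
  have : WellPowered.{v} D := wellPowered_of_isDetecting hZ.isDetecting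
  exact isLeftAdjoint_of_preservesColimits_of_isSeparating hZ H

/-- A tensor category with a conservative right exact right adjoint functor to a pre-geometric
category is pre-geometric. -/
lemma isPregeometric_of_isCohomologicallyAffine (hC : IsPregeometric R C)
    (hD : IsTensorCategory R D) {F : C ⥤ D} [F.Monoidal] [F.Additive] {G : D ⥤ C} (adj : F ⊣ G)
    [G.Faithful] [G.ReflectsIsomorphisms] [PreservesFiniteColimits G] : IsPregeometric R D := by
  let := hC.abelian.toAbelian
  have := hD.hasColimits
  have := hasFiniteLimits_of_adjunction adj
  have := adj.right_adjoint_additive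
  have : PreservesLimits G := adj.rightAdjoint_preservesLimits
  obtain ⟨ι, Z, hZ, hsep⟩ := hC.exists_family
  refine { hD with
    abelian := isAbelianCat_of_reflectsIsomorphisms G
    generator := (isSeparating_map adj Z hsep).of_le ?_ }
  rintro _ ⟨i⟩
  exact hasDual_map F (hZ i)


/-- The image of a faithfully flat algebra under `F` is faithfully flat. -/
lemma isFaithfullyFlatAlgebra_map {C : Type u₁} [Category.{v} C] [MonoidalCategory C]
    [SymmetricCategory C] {D : Type u₂} [Category.{v} D] [MonoidalCategory D] [SymmetricCategory D]
    [HasFiniteLimits D] {F : C ⥤ D} [F.Monoidal] {G : D ⥤ C} [G.Faithful] [PreservesFiniteLimits G]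
    {B : Type v} [CommRing B] {W : C ⥤ ModuleCat.{v} B} [W.Monoidal] [W.Faithful]
    [PreservesFiniteLimits W] [(G ⋙ W).LaxMonoidal] [(G ⋙ W).ReflectsIsomorphisms]
    (θ : W ⟶ F ⋙ G ⋙ W) (hθ : ∀ X Y, IsIso (projection θ X Y))
    (hD : ∀ X : D, (tensorLeft X).IsLeftAdjoint) (A : C) [MonObj A] [IsCommMonObj A]
    [MonObj (F.obj A)] [IsCommMonObj (F.obj A)]
    (hA : IsFaithfullyFlatAlgebra A) : IsFaithfullyFlatAlgebra (F.obj A) := by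
  have := hA.faithful
  have := hA.leftExact
  have (Y : D) : IsIso ((projectionRight θ A).app Y) := hθ A Y
  have := NatIso.isIso_of_isIso_app (projectionRight θ A)
  -- `W(A ⊗ G Y) ≅ W A ⊗ W(G Y) ≅ W(G(F A ⊗ Y))`: the left side is faithful and left exact in `Y`.
  let e : G ⋙ tensorLeft A ⋙ W ≅ tensorLeft (F.obj A) ⋙ G ⋙ W :=
    Functor.isoWhiskerLeft G (Functor.Monoidal.commTensorLeft W A).symm ≪≫
      asIso (projectionRight θ A)
  have : (tensorLeft (F.obj A) ⋙ G ⋙ W).Faithful := .of_iso e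
  have : PreservesFiniteLimits (tensorLeft (F.obj A) ⋙ G ⋙ W) :=
    preservesFiniteLimits_of_natIso e
  have := hD (F.obj A)
  exact
    { faithful := .of_comp (tensorLeft (F.obj A)) (G ⋙ W)
      leftExact := preservesFiniteLimits_of_reflects_of_preserves _ (G ⋙ W)
      rightExact := inferInstance }

/-- A pre-geometric category with a faithful, exact and cocontinuous lax braided functor to modules
is geometric if the projection morphisms at a small separating family are isomorphisms. -/
lemma isGeometric_of_isIso_projection [SymmetricCategory D] (hD : IsPregeometric R D)
    {C : Type u₁} [Category.{v} C] [MonoidalCategory C] {F : C ⥤ D} [F.Monoidal]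
    {B : Type v} [CommRing B] [Algebra R B]
    {W : C ⥤ ModuleCat.{v} B} [W.Monoidal] {L : D ⥤ ModuleCat.{v} B} [L.LaxBraided] [L.Additive]
    [L.Linear R] [L.Faithful] [PreservesFiniteLimits L] [PreservesColimits L]
    (θ : W ⟶ F ⋙ L) {ι : Type v} (Z : ι → C)
    (hsep : (ObjectProperty.ofObj fun i ↦ F.obj (Z i)).IsSeparating)
    (hL : ∀ i Y, IsIso (projection θ (Z i) Y)) : IsGeometric R D := by
  let := hD.abelian.toAbelian
  have := hD.hasColimits
  have := isIso_lift_μ θ Z hsep hL hD.closed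
  let : (lift L).Monoidal := .ofLaxMonoidal _
  let : (lift L).Braided := { braided := Functor.LaxBraided.braided (F := lift L) }
  let : Algebra R (UnitRing L) := unitRingAlgebra L
  have : PreservesFiniteColimits (lift L) := PreservesColimits.preservesFiniteColimits _
  have h : IsFaithfullyFlatCovering R (UnitRing L) (lift L) :=
    { additive := lift_additive L
      linear := lift_linear L
      isLeftAdjoint := isLeftAdjoint_of_isSeparating hsep _
      faithful := inferInstance
      leftExact := inferInstance
      rightExact := inferInstance }
  exact { hD with exists_covering := ⟨UnitRing L, _, _, lift L, _, h⟩ }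

end Main

end GeomTensor

theorem proposition4 {R : Type w} [CommRing R]
    {C : Type u₁} [Category.{v} C] [Preadditive C] [Linear R C] [MonoidalCategory C]
    [SymmetricCategory C]
    {D : Type u₂} [Category.{v} D] [Preadditive D] [Linear R D] [MonoidalCategory D]
    [SymmetricCategory D]
    (hC : GeomTensor.IsGeometric R C) (hD : GeomTensor.IsTensorCategory R D)
    (F : C ⥤ D) [F.Braided] [GeomTensor.IsTensorFunctor R F]
    (hF : GeomTensor.IsCohomologicallyAffine F)
    (hU : F.rightAdjoint.ReflectsIsomorphisms) :
    GeomTensor.IsGeometric R D ∧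
      ∀ (A : C) [MonObj A] [IsCommMonObj A],
        GeomTensor.IsFaithfullyFlatAlgebra A → GeomTensor.IsAffineAlgebra A →
          GeomTensor.IsFaithfullyFlatAlgebra (F.obj A) ∧
            GeomTensor.IsAffineAlgebra (F.obj A) := by
  have hFR : GeomTensor.IsTensorFunctor R F := inferInstance
  have := hFR.additive
  have := hFR.linear
  have := hF.faithful
  have := hF.rightExact
  let adj := Adjunction.ofIsLeftAdjoint F
  have hD' := GeomTensor.isPregeometric_of_isCohomologicallyAffine hC.toIsPregeometric hD adj
  let := hC.abelian.toAbelian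
  let := hD'.abelian.toAbelian
  have := hC.hasColimits
  have := hD.hasColimits
  have := hD.monoidalPreadditive
  obtain ⟨ι, Z, hZ, hsep⟩ := hC.exists_family
  have hfp (X : C) (hX : ObjectProperty.ofObj Z X) : GeomTensor.hasDual C X := by
    obtain ⟨i⟩ := hX
    exact hZ i
  have := adj.right_adjoint_additive
  have := GeomTensor.rightAdjoint_linear R adj
  have := adj.rightAdjoint_preservesLimits
  have : PreservesColimits F := adj.leftAdjoint_preservesColimits
  -- `Z i` and `F (Z i)` are both dualizable, hence finitely presentable.
  have := GeomTensor.preservesColimits_rightAdjoint adj hsep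
    (fun X hX ↦ hC.isFinitelyPresentable_of_hasDual X (hfp X hX))
    (fun X hX ↦ hD.isFinitelyPresentable_of_hasDual _ (GeomTensor.hasDual_map F (hfp X hX)))
  let := adj.rightAdjointLaxMonoidal
  let := GeomTensor.rightAdjointLaxBraided adj
  obtain ⟨B, _, _, W, _, hW⟩ := hC.exists_covering
  have := hW.additive
  have := hW.linear
  have := hW.faithful
  have := hW.leftExact
  have : PreservesColimits W := (Adjunction.ofIsLeftAdjoint W).leftAdjoint_preservesColimits
  let θ : W ⟶ F ⋙ F.rightAdjoint ⋙ W := Functor.whiskerRight adj.unit W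
  have : NatTrans.IsMonoidal θ := GeomTensor.isMonoidal_whiskerRight_unit adj W
  have hθ (X : C) (Y : D) : IsIso (GeomTensor.LaxModule.projection θ X Y) :=
    have := hD.closed Y
    GeomTensor.LaxModule.isIso_projection θ Z hZ hsep Y X
  refine ⟨GeomTensor.isGeometric_of_isIso_projection hD' θ Z
    (GeomTensor.isSeparating_map adj Z hsep) fun i ↦ hθ (Z i), fun A _ _ hA hA' ↦ ⟨?_, ?_⟩⟩
  · exact GeomTensor.isFaithfullyFlatAlgebra_map θ hθ hD.closed A hA
  · exact GeomTensor.isAffineAlgebra_map adj A hD.closed hA'
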